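/- Let $q=p^t$ be a power of a prime $p$, let $n$ be an odd prime, and consider the tower of finite fields $\mathbb F_q\subset\mathbb F_{q^n}\subset\mathbb F_{q^{n^2}}$. Let $\mathbb S$ be the set of all elements of $\mathbb F_{q^{n^2}}$ of degree $n$ over $\mathbb F_{q^n}$. For $\alpha\in\mathbb S$ let $$O(\alpha)=\left\{\tfrac{a\alpha+b}{c\alpha+d} : a,b,c,d\in\mathbb F_{q^n},\ ad-bc\neq 0\right\}$$ be the orbit of $\alpha$ under $PGL(2,q^n)$, and let $\mathbb O=\{O(\alpha):\alpha\in\mathbb S\}$. Let $G=\langle\sigma\rangle$ be the group generated by the Frobenius automorphism $\sigma:x\mapsto x^q$ of $\mathbb F_{q^{n^2}}$; it acts on $\mathbb O$. Then the number of orbits in $\mathbb O$ under the action of $G$ is $$\begin{cases} \frac{1}{n^2}\left[\frac{q^{n(n-1)}-1}{q^{2n}-1}+n^2-1\right], & n=p,\\[2pt] \frac{1}{n^2}\left[\frac{q^{n(n-1)}-1}{q^{2n}-1}+\frac{(n^2-1)(n-1)}{2}\right], & n\neq p,\ n\mid q^n-1,\\[2pt] \frac{1}{n^2}\left[\frac{q^{n(n-1)}-1}{q^{2n}-1}+\frac{(n+1)(n-1)^2}{2}\right],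 & n\neq p,\ n\nmid q^n-1,\ n\mid q^n+1,\\[2pt] \frac{1}{n^2}\cdot\frac{q^{n(n-1)}-1}{q^{2n}-1}, & n\neq p,\ n\nmid q^n-1,\ n\nmid q^n+1. \end{cases}$$ Moreover, this number is an upper bound for the number of extended irreducible Goppa codes over $\mathbb F_q$ of degree $n$ and length $q^n+1$, counted up to equivalence (permutation of the coordinates). Here, for $g\in\mathbb F_{q^n}[z]$ irreducible of degree $n$, the irreducible Goppa code of degree $n$ is $\Gamma(L,g)=\{(c_\zeta)_{\zeta\in L}\in\mathbb F_q^{L}:\sum_{\zeta\in L}\frac{c_\zeta}{z-\zeta}\equiv 0 \bmod g(z)\}$ with $L=\mathbb F_{q^n}$, and the extended code consists of all $(c,c_\infty)$ with $c\in\Gamma(L,g)$, $c_\infty\in\mathbb F_q$ and $c_\infty+\sum_{\zeta\in L} c_\zeta=0$. -/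

import Mathlib

open scoped Pointwise Polynomial

noncomputable section

namespace GoppaCount

/-! Throughout, `F ⊆ K ⊆ E` is a tower of finite fields, to be thought of as
`𝔽_q ⊆ 𝔽_{q^n} ⊆ 𝔽_{q^{nr}}`. -/

/-- The set `𝕊 = 𝕊(n, r)` of all elements of `E` of degree `r` over `K`. -/
def elementsOfDegree (K E : Type*) [Field K] [Field E] [Algebra K E] (r : ℕ) : Set E :=
  {α | (minpoly K α).natDegree = r}

/-- The map `[A](α) = (a α + b) / (c α + d)` for `A = !![a, b; c, d]` in `GL(2, K)`. -/
def moebius {K E : Type*} [Field K] [Field E] [Algebra K E]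
    (A : Matrix.GeneralLinearGroup (Fin 2) K) (α : E) : E :=
  (algebraMap K E (A.1 0 0) * α + algebraMap K E (A.1 0 1)) /
    (algebraMap K E (A.1 1 0) * α + algebraMap K E (A.1 1 1))

/-- The projective linear set `O(α) = {(a α + b) / (c α + d) : a, b, c, d ∈ K, ad - bc ≠ 0}`. -/
def projectiveLinearSet (K : Type*) {E : Type*} [Field K] [Field E] [Algebra K E] (α : E) :
    Set E :=
  Set.range fun A : Matrix.GeneralLinearGroup (Fin 2) K => moebius A α

section Frobenius

variable (F K E : Type*) [Field F] [Field K] [Field E]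
  [Algebra F K] [Algebra K E] [Algebra F E]

/-- The group `G = ⟨σ⟩` generated by the Frobenius automorphism `σ : α ↦ α ^ q` of `E` over `F`,
where `q = |F|`. -/
def frobeniusGroup [Fintype F] [Fintype E] : Subgroup (E ≃ₐ[F] E) :=
  Subgroup.zpowers (FiniteField.frobeniusAlgEquivOfAlgebraic F E)

variable {F E}

theorem smul_projectiveLinearSet [Fintype K] [IsScalarTower F K E] (s : E ≃ₐ[F] E) (α : E) :
    s • projectiveLinearSet K α = projectiveLinearSet K (s • α) := by
  have key : ∀ (s : E ≃ₐ[F] E) (α : E),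
      s • projectiveLinearSet K α ⊆ projectiveLinearSet K (s • α) := by
    rintro s α _ ⟨_, ⟨A, rfl⟩, rfl⟩
    refine ⟨Matrix.GeneralLinearGroup.map
      ((s.restrictNormal K : K ≃ₐ[F] K) : K →+* K) A, ?_⟩
    simp [moebius, AlgEquiv.smul_def, AlgEquiv.restrictNormal_commutes]
  refine (key s α).antisymm ?_
  have h := key s⁻¹ (s • α)
  rw [inv_smul_smul] at h
  rwa [← Set.subset_smul_set_iff] at h

theorem smul_mem_elementsOfDegree [Fintype K] [Fintype E] [IsScalarTower F K E] (s : E ≃ₐ[F] E) {α : E} {r : ℕ}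
    (h : α ∈ elementsOfDegree K E r) : s • α ∈ elementsOfDegree K E r := by
  have hint : IsIntegral K α := .of_finite K α
  have hmin : (minpoly K α).map (((s.restrictNormal K : K ≃ₐ[F] K) : K ≃+* K) : K →+* K) =
      minpoly K (s • α) := by
    refine minpoly.eq_of_irreducible_of_monic ?_ ?_ ((minpoly.monic hint).map _)
    · exact (MulEquiv.irreducible_iff
        (Polynomial.mapEquiv ((s.restrictNormal K : K ≃ₐ[F] K) : K ≃+* K))).2
        (minpoly.irreducible hint)
    · have hc : (algebraMap K E).comp (((s.restrictNormal K : K ≃ₐ[F] K) : K ≃+* K) : K →+* K) =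
          ((s : E ≃+* E) : E →+* E).comp (algebraMap K E) := by
        ext x
        exact AlgEquiv.restrictNormal_commutes s K x
      have h0 := congrArg s (minpoly.aeval K α)
      rw [Polynomial.aeval_def, map_zero] at h0
      rw [Polynomial.aeval_def, Polynomial.eval₂_map, hc, ← h0]
      exact (Polynomial.hom_eval₂ _ _ ((s : E ≃+* E) : E →+* E) _).symm
  rw [elementsOfDegree, Set.mem_ofPred_eq, ← hmin, Polynomial.natDegree_map]
  exact h

variable (F E)

/-- The set `𝕆 = {O(α) : α ∈ 𝕊}` with the action of `G` on it, `g • X = {g x : x ∈ X}`. -/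
def projectiveLinearSets [Fintype F] [Fintype K] [Fintype E] [IsScalarTower F K E] (r : ℕ) :
    SubMulAction (frobeniusGroup F E) (Set E) where
  carrier := projectiveLinearSet K '' elementsOfDegree K E r
  smul_mem' := by
    rintro s _ ⟨α, hα, rfl⟩
    exact ⟨(s : E ≃ₐ[F] E) • α, smul_mem_elementsOfDegree K _ hα,
      (smul_projectiveLinearSet K (s : E ≃ₐ[F] E) α).symm⟩

/-- The number of orbits in `𝕆` under the action of `G`. -/
def numOrbits [Fintype F] [Fintype K] [Fintype E] [IsScalarTower F K E] (r : ℕ) : ℕ :=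
  Nat.card (MulAction.orbitRel.Quotient (frobeniusGroup F E) (projectiveLinearSets F K E r))

end Frobenius

section Codes

variable (F : Type*) {K : Type*} [Field F] [Field K] [Fintype K] [Algebra F K]

/-- The Goppa code `Γ(L, g)` with `L = K`: all vectors `c` over `F`, with coordinates indexed by
the elements `ζ` of `K`, such that `∑ ζ, c ζ / (z - ζ) ≡ 0 mod g(z)`, an equation in the residue
ring `K[z]/(g)`, in which `z - ζ` is invertible whenever `g(ζ) ≠ 0`. -/
def goppaCode (g : K[X]) : Submodule F (K → F) where
  carrier := {c | ∑ ζ : K, c ζ • Ring.inverse (AdjoinRoot.root g - AdjoinRoot.of g ζ) = 0}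
  zero_mem' := by simp
  add_mem' := by
    intro a b ha hb
    simp only [Set.mem_ofPred_eq] at ha hb ⊢
    simp [add_smul, Finset.sum_add_distrib, ha, hb]
  smul_mem' := by
    intro a b hb
    simp only [Set.mem_ofPred_eq] at hb ⊢
    simp [mul_smul, ← Finset.smul_sum, hb]

/-- The Goppa code extended by an overall parity check; `none` is the index of the additional
coordinate, so that the length is `|K| + 1`. -/
def extendedGoppaCode (g : K[X]) : Submodule F (Option K → F) where
  carrier := {c | (fun ζ => c (some ζ)) ∈ goppaCode F g ∧ ∑ i, c i = 0}
  zero_mem' := ⟨(goppaCode F g).zero_mem, by simp⟩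
  add_mem' := by
    rintro a b ⟨ha, ha'⟩ ⟨hb, hb'⟩
    exact ⟨(goppaCode F g).add_mem ha hb, by
      simp only [Pi.add_apply, Finset.sum_add_distrib, ha', hb', add_zero]⟩
  smul_mem' := by
    rintro a b ⟨hb, hb'⟩
    exact ⟨(goppaCode F g).smul_mem a hb, by
      simp only [Pi.smul_apply, ← Finset.smul_sum, hb', smul_zero]⟩

/-- Equivalence of linear codes: one is obtained from the other by a permutation of the
coordinates. -/
def codeEquivalence (F ι : Type*) [Field F] : Setoid (Submodule F (ι → F)) where
  r C D := ∃ π : Equiv.Perm ι, ∀ c : ι → F, c ∈ D ↔ c ∘ π ∈ C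
  iseqv :=
    { refl := fun _ => ⟨1, fun _ => Iff.rfl⟩
      symm := by
        rintro C D ⟨π, h⟩
        refine ⟨π⁻¹, fun c => ?_⟩
        rw [h]
        have : (c ∘ ⇑π⁻¹) ∘ ⇑π = c := by ext; simp
        rw [this]
      trans := by
        rintro C D B ⟨π, h⟩ ⟨τ, h'⟩
        exact ⟨τ * π, fun c => (h' c).trans (h _)⟩ }

variable (K)

/-- The extended irreducible Goppa codes of degree `r` over `F`, of length `|K| + 1`. -/
def extendedIrreducibleGoppaCodes (r : ℕ) : Set (Submodule F (Option K → F)) :=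
  {C | ∃ g : K[X], Irreducible g ∧ g.natDegree = r ∧ C = extendedGoppaCode F g}

/-- The number of extended irreducible Goppa codes of degree `r` over `F`, of length `|K| + 1`,
up to equivalence of codes. -/
def numExtendedIrreducibleGoppaCodes (r : ℕ) : ℕ :=
  Nat.card (Quotient ((codeEquivalence F (Option K)).comap
    (Subtype.val : extendedIrreducibleGoppaCodes F K r → Submodule F (Option K → F))))

end Codes

end GoppaCount

end

/-!
Write `Q = q ^ n = |K|`, and let `𝕆` be the set of the projective linear sets `O(α)`.

The stabilizer in `GL(2, K)` of an element `α` of degree `n ≥ 3` consists of the scalar matrices,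
since any other would give a quadratic equation for `α`. Hence every `O(α)` has `Q³ - Q` elements
and `|𝕆| = (Q ^ (n - 1) - 1) / (Q² - 1)` (`ncard_image_projectiveLinearSet`).

The group `G` is cyclic of order `n²`, and its subgroup of order `n` is generated by the Frobenius
automorphism `φ : x ↦ x ^ Q` of `E` over `K`. The heart of the proof is that `φ` fixes fewer than
`n` points of `𝕆` (`ncard_frobenius_fixed_lt`). If `φ α = [A] α` with `A` in `GL(2, K)`, then the
cross-ratio of `α, φ α, φ² α, φ³ α` is `k = (tr A)² / det A`, which lies in `K` and depends only on
`O(α)`. As `φ ^ n = 1`, the matrix `A ^ n` is scalar, and this says that `k` is a root of a monic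
polynomial of degree `n - 1` (`eval_powPoly_eq_zero`). Conversely `k` determines `O(α)`: the
elements of `E` outside `K` with cross-ratio `k` are roots of a polynomial of degree `Q³ - Q`
(`ncard_conjCrossRatio_le`), so they fill at most one projective linear set.

Every nontrivial `g` in `G` generates a subgroup that contains `φ`, so `g` also has fewer than `n`
fixed points, and as `G` is an `n`-group that number is congruent to `|𝕆|` modulo `n`. It is
therefore `|𝕆| % n`, and Burnside's lemma gives `n²` times the number of orbits as
`|𝕆| + (n² - 1) (|𝕆| % n)` (`card_orbits_mul_sq`). The residue `|𝕆| % n` is `1` if `n = p`,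
`(n - 1) / 2` if `n` divides `Q² - 1`, and `0` otherwise.

For the codes, let `α` be a root in `E` of the Goppa polynomial. The extended code is the set of
vectors over `F` orthogonal to the functions `1` and `P ↦ 1 / (α - P)` on the projective line over
`K`. An element of `GL(2, K)` acting on both `α` and `P` changes the latter function by a
nonconstant affine map (`invSub_moebius`), and an automorphism of `E` over `F` by its own action on
the values (`invSub_frobenius`), which the `F`-linear relations do not see. So the code depends, up
to a permutation of the projective line, only on the orbit of `O(α)` under `G`.
-/

namespace GoppaCount

/-! ### Möbius transformations of elements of degree at least three -/

section Moebius

variable {K E : Type*} [Field K] [Field E] [Algebra K E]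

theorem eq_zero_of_quadratic {α : E} (hα : 2 < (minpoly K α).natDegree) {a b c : K}
    (h : algebraMap K E a * α ^ 2 + algebraMap K E b * α + algebraMap K E c = 0) :
    a = 0 ∧ b = 0 ∧ c = 0 := by
  have h0 : Polynomial.C a * Polynomial.X ^ 2 + Polynomial.C b * Polynomial.X +
      Polynomial.C c = 0 := by
    by_contra hne
    have h1 := Polynomial.natDegree_le_natDegree
      (minpoly.degree_le_of_ne_zero K α hne (by simpa [Polynomial.aeval_def] using h))
    exact absurd (h1.trans Polynomial.natDegree_quadratic_le) (by omega)
  refine ⟨?_, ?_, ?_⟩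
  · simpa using congrArg (fun f : K[X] => f.coeff 2) h0
  · simpa using congrArg (fun f : K[X] => f.coeff 1) h0
  · simpa using congrArg (fun f : K[X] => f.coeff 0) h0

theorem eq_zero_of_linear {α : E} (hα : 2 < (minpoly K α).natDegree) {a b : K}
    (h : algebraMap K E a * α + algebraMap K E b = 0) : a = 0 ∧ b = 0 :=
  (eq_zero_of_quadratic hα (a := 0) (b := a) (c := b) (by simpa using h)).2

theorem algebraMap_ne {α : E} (hα : 2 < (minpoly K α).natDegree) (x : K) :
    algebraMap K E x ≠ α := by
  intro h
  have := eq_zero_of_linear hα (a := 1) (b := -x) (by simp [h])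
  simp at this

theorem denom_ne_zero {α : E} (hα : 2 < (minpoly K α).natDegree)
    (A : Matrix.GeneralLinearGroup (Fin 2) K) :
    algebraMap K E (A.1 1 0) * α + algebraMap K E (A.1 1 1) ≠ 0 := by
  intro h
  obtain ⟨h1, h2⟩ := eq_zero_of_linear hα h
  refine A.det_ne_zero ?_
  rw [Matrix.det_fin_two, h1, h2]
  simp

theorem moebius_one (α : E) : moebius (1 : Matrix.GeneralLinearGroup (Fin 2) K) α = α := by
  simp [moebius]

theorem moebius_mul {α : E} (hα : 2 < (minpoly K α).natDegree)
    (A B : Matrix.GeneralLinearGroup (Fin 2) K) :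
    moebius (A * B) α = moebius A (moebius B α) := by
  have hB := denom_ne_zero hα B
  have hAB := denom_ne_zero hα (A * B)
  simp only [moebius, Units.val_mul, Matrix.mul_apply, Fin.sum_univ_two, map_add, map_mul] at hAB ⊢
  have h2 : algebraMap K E (A.1 1 0) * ((algebraMap K E (B.1 0 0) * α + algebraMap K E (B.1 0 1)) /
      (algebraMap K E (B.1 1 0) * α + algebraMap K E (B.1 1 1))) + algebraMap K E (A.1 1 1) ≠ 0 := by
    intro h
    rw [mul_div_assoc', div_add' _ _ _ hB, div_eq_zero_iff, or_iff_left hB] at h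
    exact hAB (by linear_combination h)
  rw [div_eq_div_iff hAB h2]
  field_simp
  ring

theorem minpoly_natDegree_moebius [FiniteDimensional K E] {α : E}
    (hα : 2 < (minpoly K α).natDegree) (A : Matrix.GeneralLinearGroup (Fin 2) K) :
    (minpoly K (moebius A α)).natDegree = (minpoly K α).natDegree := by
  have key : ∀ (B : Matrix.GeneralLinearGroup (Fin 2) K) (β : E),
      IntermediateField.adjoin K {moebius B β} ≤ IntermediateField.adjoin K {β} := by
    intro B β
    rw [IntermediateField.adjoin_simple_le_iff]
    have hβ := IntermediateField.mem_adjoin_simple_self K β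
    exact div_mem (add_mem (mul_mem (algebraMap_mem _ _) hβ) (algebraMap_mem _ _))
      (add_mem (mul_mem (algebraMap_mem _ _) hβ) (algebraMap_mem _ _))
  have heq : IntermediateField.adjoin K {moebius A α} = IntermediateField.adjoin K {α} := by
    refine (key A α).antisymm ?_
    have h := key A⁻¹ (moebius A α)
    rwa [← moebius_mul hα, inv_mul_cancel, moebius_one] at h
  rw [← IntermediateField.adjoin.finrank (.of_finite K _), heq,
    IntermediateField.adjoin.finrank (.of_finite K _)]

theorem moebius_eq_self_iff {α : E} (hα : 2 < (minpoly K α).natDegree)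
    (A : Matrix.GeneralLinearGroup (Fin 2) K) :
    moebius A α = α ↔ A ∈ (Matrix.GeneralLinearGroup.scalar (Fin 2) : Kˣ →* _).range := by
  constructor
  · intro h
    rw [moebius, div_eq_iff (denom_ne_zero hα A)] at h
    obtain ⟨h1, h2, h3⟩ := eq_zero_of_quadratic hα (a := A.1 1 0) (b := A.1 1 1 - A.1 0 0)
      (c := - A.1 0 1) (by simp only [map_sub, map_neg]; linear_combination -h)
    have hd := A.det_ne_zero
    have h2' : A.1 1 1 = A.1 0 0 := by linear_combination h2
    have h3' : A.1 0 1 = 0 := by linear_combination -h3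
    rw [Matrix.det_fin_two, h1, h2', h3'] at hd
    have h0 : A.1 0 0 ≠ 0 := by rintro h0; simp [h0] at hd
    refine ⟨Units.mk0 _ h0, ?_⟩
    ext i j
    fin_cases i <;> fin_cases j <;> simp [h1, h2', h3']
  · rintro ⟨u, rfl⟩
    simp [moebius, Matrix.GeneralLinearGroup.coe_scalar]

/-- The action of `GL(2, K)` on the elements of degree `r ≥ 3` by Möbius transformations. -/
abbrev moebiusAction [FiniteDimensional K E] {r : ℕ} (hr : 2 < r) :
    MulAction (Matrix.GeneralLinearGroup (Fin 2) K) (elementsOfDegree K E r) where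
  smul A α := ⟨moebius A α.1, by
    have hα : (minpoly K α.1).natDegree = r := α.2
    exact (minpoly_natDegree_moebius (by omega) A).trans hα⟩
  one_smul α := Subtype.ext (moebius_one α.1)
  mul_smul A B α := Subtype.ext <| by
    have hα : (minpoly K α.1).natDegree = r := α.2
    exact moebius_mul (by omega) A B

theorem mem_projectiveLinearSet_self (α : E) : α ∈ projectiveLinearSet K α :=
  ⟨1, moebius_one α⟩

theorem projectiveLinearSet_eq_of_mem {α β : E} (hα : 2 < (minpoly K α).natDegree)
    (h : β ∈ projectiveLinearSet K α) : projectiveLinearSet K β = projectiveLinearSet K α := by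
  obtain ⟨A, rfl⟩ := h
  apply Set.Subset.antisymm
  · rintro _ ⟨B, rfl⟩
    exact ⟨B * A, moebius_mul hα B A⟩
  · rintro _ ⟨B, rfl⟩
    refine ⟨B * A⁻¹, ?_⟩
    simp only
    rw [← moebius_mul hα, inv_mul_cancel_right]

theorem projectiveLinearSet_eq_iff {α β : E} (hα : 2 < (minpoly K α).natDegree) :
    projectiveLinearSet K β = projectiveLinearSet K α ↔ β ∈ projectiveLinearSet K α :=
  ⟨fun h => h ▸ mem_projectiveLinearSet_self β, projectiveLinearSet_eq_of_mem hα⟩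

theorem projectiveLinearSet_subset [FiniteDimensional K E] {r : ℕ} (hr : 2 < r) {α : E}
    (hα : α ∈ elementsOfDegree K E r) : projectiveLinearSet K α ⊆ elementsOfDegree K E r := by
  rintro _ ⟨A, rfl⟩
  have hα : (minpoly K α).natDegree = r := hα
  exact (minpoly_natDegree_moebius (by omega) A).trans hα

/-- Orbit–stabilizer: the scalar matrices are exactly the stabilizer of an element of degree at
least three. -/
theorem ncard_projectiveLinearSet [Fintype K] [Finite E] {α : E}
    (hα : 2 < (minpoly K α).natDegree) :
    (projectiveLinearSet K α).ncard = Fintype.card K ^ 3 - Fintype.card K := by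
  classical
  let := moebiusAction (K := K) (E := E) hα
  let a : elementsOfDegree K E (minpoly K α).natDegree := ⟨α, rfl⟩
  have horb : Subtype.val '' MulAction.orbit (Matrix.GeneralLinearGroup (Fin 2) K) a =
      projectiveLinearSet K α := by
    rw [MulAction.orbit, ← Set.range_comp]
    rfl
  have hstab : MulAction.stabilizer (Matrix.GeneralLinearGroup (Fin 2) K) a =
      (Matrix.GeneralLinearGroup.scalar (Fin 2) : Kˣ →* _).range := by
    ext A
    rw [MulAction.mem_stabilizer_iff, ← moebius_eq_self_iff hα, Subtype.ext_iff]
    rfl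
  have hinj : Function.Injective
      (Matrix.GeneralLinearGroup.scalar (Fin 2) : Kˣ →* Matrix.GeneralLinearGroup (Fin 2) K) := by
    intro u v h
    have := congrArg (fun A : Matrix.GeneralLinearGroup (Fin 2) K => A.1 0 0) h
    ext
    simpa using this
  have : Fintype (MulAction.orbit (Matrix.GeneralLinearGroup (Fin 2) K) a) := Fintype.ofFinite _
  have h1 := MulAction.card_orbit_mul_card_stabilizer_eq_card_group
    (Matrix.GeneralLinearGroup (Fin 2) K) a
  rw [← Nat.card_eq_fintype_card, ← Nat.card_eq_fintype_card, ← Nat.card_eq_fintype_card,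
    hstab, Matrix.card_GL_field, Fin.prod_univ_two,
    ← Nat.card_congr (MonoidHom.ofInjective hinj).toEquiv, Nat.card_units,
    Nat.card_eq_fintype_card (α := K)] at h1
  rw [← horb, Set.ncard_image_of_injective _ Subtype.val_injective, ← Nat.card_coe_set_eq]
  have hQ : 1 < Fintype.card K := Fintype.one_lt_card
  set Q := Fintype.card K
  refine Nat.eq_of_mul_eq_mul_right (by omega : 0 < Q - 1) (h1.trans ?_)
  obtain ⟨m, hm⟩ : ∃ m, Q = m + 1 := ⟨Q - 1, by omega⟩
  rw [hm]
  simp only [Fin.val_zero, Fin.val_one, pow_zero, pow_one, Nat.add_sub_cancel]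
  zify [Nat.one_le_pow 2 (m + 1) (by omega), Nat.le_self_pow (two_ne_zero) (m + 1),
    Nat.le_self_pow (three_ne_zero) (m + 1)]
  ring

end Moebius

/-! ### The cross-ratio of four consecutive conjugates -/

section CrossRatio

variable {K E : Type*} [Field K] [Field E] [Algebra K E]

/-- The cross-ratio of `α, φ α, φ² α, φ³ α` for an endomorphism `φ` of `E`. -/
noncomputable def conjCrossRatio (φ : E →ₐ[K] E) (α : E) : E :=
  (α - φ (φ α)) * (φ α - φ (φ (φ α))) / ((α - φ α) * (φ (φ α) - φ (φ (φ α))))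

theorem map_moebius (φ : E →ₐ[K] E) (A : Matrix.GeneralLinearGroup (Fin 2) K) (α : E) :
    φ (moebius A α) = moebius A (φ α) := by
  simp [moebius]

/-- If `φ` acts on `α` as the Möbius transformation `[A]`, then the cross-ratio is the conjugacy
invariant `(tr A)² / det A` of `[A]`. -/
theorem conjCrossRatio_eq (φ : E →ₐ[K] E) {α : E} (hα : 2 < (minpoly K α).natDegree)
    (hφ : φ α ≠ α) {A : Matrix.GeneralLinearGroup (Fin 2) K} (hA : φ α = moebius A α) :
    conjCrossRatio φ α = algebraMap K E (A.1.trace ^ 2 / A.1.det) := by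
  have hN0 := denom_ne_zero hα A
  have h0 : φ α * (algebraMap K E (A.1 1 0) * α + algebraMap K E (A.1 1 1)) =
      algebraMap K E (A.1 0 0) * α + algebraMap K E (A.1 0 1) := by
    rw [hA, moebius, div_mul_cancel₀ _ hN0]
  have h1 := congrArg φ h0
  have hN1 := (map_ne_zero φ).2 hN0
  have hN2 := (map_ne_zero φ).2 hN1
  have h2 := congrArg φ h1
  simp only [map_mul, map_add, AlgHom.commutes] at h1 h2 hN1 hN2
  have hd : algebraMap K E A.1.det ≠ 0 := (map_ne_zero _).2 A.det_ne_zero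
  have hD01 : α - φ α ≠ 0 := sub_ne_zero.2 hφ.symm
  have hD12 : φ α - φ (φ α) ≠ 0 := by simpa using (map_ne_zero φ).2 hD01
  have hD23 : φ (φ α) - φ (φ (φ α)) ≠ 0 := by simpa using (map_ne_zero φ).2 hD12
  rw [map_div₀, conjCrossRatio, div_eq_div_iff (mul_ne_zero hD01 hD23) hd]
  have e1 : (α - φ (φ α)) * (algebraMap K E (A.1 1 0) * φ α + algebraMap K E (A.1 1 1)) =
      algebraMap K E A.1.trace * (α - φ α) := by
    simp only [Matrix.trace_fin_two, map_add]
    linear_combination h0 - h1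
  have e2 : (φ α - φ (φ (φ α))) *
      (algebraMap K E (A.1 1 0) * φ (φ α) + algebraMap K E (A.1 1 1)) =
      algebraMap K E A.1.trace * (φ α - φ (φ α)) := by
    simpa only [map_mul, map_add, map_sub, AlgHom.commutes] using congrArg φ e1
  have e3 : (φ (φ α) - φ (φ (φ α))) *
      ((algebraMap K E (A.1 1 0) * φ α + algebraMap K E (A.1 1 1)) *
      (algebraMap K E (A.1 1 0) * φ (φ α) + algebraMap K E (A.1 1 1))) =
      algebraMap K E A.1.det * (φ α - φ (φ α)) := by
    simp only [Matrix.det_fin_two, map_sub, map_mul]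
    linear_combination (algebraMap K E (A.1 1 0) * φ (φ α) + algebraMap K E (A.1 1 1)) * h1 -
      (algebraMap K E (A.1 1 0) * φ α + algebraMap K E (A.1 1 1)) * h2
  refine mul_right_cancel₀ (mul_ne_zero hN1 hN2) ?_
  rw [map_pow]
  linear_combination (algebraMap K E A.1.det) * (φ α - φ (φ (φ α))) *
      (algebraMap K E (A.1 1 0) * φ (φ α) + algebraMap K E (A.1 1 1)) * e1 +
    algebraMap K E A.1.det * algebraMap K E A.1.trace * (α - φ α) * e2 -
    algebraMap K E A.1.trace ^ 2 * (α - φ α) * e3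

/-- The cross-ratio is constant on `O(α)` when `φ` preserves `O(α)`. -/
theorem conjCrossRatio_moebius [FiniteDimensional K E] (φ : E →ₐ[K] E) {α : E}
    (hα : 2 < (minpoly K α).natDegree)
    (hφ : φ α ≠ α) {A : Matrix.GeneralLinearGroup (Fin 2) K} (hA : φ α = moebius A α)
    (B : Matrix.GeneralLinearGroup (Fin 2) K) :
    φ (moebius B α) ≠ moebius B α ∧
      conjCrossRatio φ (moebius B α) = conjCrossRatio φ α := by
  have hB : φ (moebius B α) = moebius (B * A * B⁻¹) (moebius B α) := by
    rw [map_moebius, hA, ← moebius_mul hα, ← moebius_mul hα, inv_mul_cancel_right]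
  have hne : φ (moebius B α) ≠ moebius B α := by
    intro h
    rw [map_moebius, hA] at h
    apply hφ
    have h' := congrArg (moebius B⁻¹) h
    rwa [← moebius_mul hα, ← moebius_mul hα, ← moebius_mul hα, inv_mul_cancel_left, inv_mul_cancel,
      moebius_one, ← hA] at h'
  refine ⟨hne, ?_⟩
  rw [conjCrossRatio_eq φ hα hφ hA,
    conjCrossRatio_eq φ (by rwa [minpoly_natDegree_moebius hα]) hne hB]
  simp only [Units.val_mul, Matrix.coe_units_inv]
  rw [← Matrix.coe_units_inv, Matrix.trace_units_conj, Matrix.det_units_conj]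

/-- The polynomials `P₀ = 0`, `P₁ = 1`, `Pⱼ₊₂ = X (Pⱼ₊₁ - Pⱼ)`. If `M` is a `2 × 2` matrix of
trace and determinant `k`, then `M ^ j = Pⱼ(k) M - k Pⱼ₋₁(k)`. -/
noncomputable def powPoly (K : Type*) [Field K] : ℕ → K[X]
  | 0 => 0
  | 1 => 1
  | j + 2 => Polynomial.X * (powPoly K (j + 1) - powPoly K j)

theorem powPoly_monic (j : ℕ) :
    (powPoly K (j + 1)).Monic ∧ (powPoly K (j + 1)).natDegree = j := by
  induction j using Nat.strong_induction_on with
  | _ j ih =>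
    match j, ih with
    | 0, _ => simp [powPoly]
    | 1, _ => simp [powPoly, Polynomial.monic_X]
    | j + 2, ih =>
      obtain ⟨h1, h2⟩ : (powPoly K (j + 2)).Monic ∧ (powPoly K (j + 2)).natDegree = j + 1 :=
        ih (j + 1) (by omega)
      obtain ⟨h3, h4⟩ := ih j (by omega)
      have hlt : (powPoly K (j + 1)).degree < (powPoly K (j + 2)).degree := by
        rw [Polynomial.degree_eq_natDegree h1.ne_zero, Polynomial.degree_eq_natDegree h3.ne_zero,
          h2, h4]
        exact_mod_cast Nat.lt_succ_self j
      have hm : (powPoly K (j + 2) - powPoly K (j + 1)).Monic := h1.sub_of_left hlt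
      have hdeg : (powPoly K (j + 2) - powPoly K (j + 1)).natDegree = j + 1 := by
        rw [Polynomial.natDegree_sub_eq_left_of_natDegree_lt (by omega), h2]
      refine ⟨Polynomial.monic_X.mul hm, ?_⟩
      rw [powPoly, Polynomial.Monic.natDegree_mul Polynomial.monic_X hm, hdeg]
      simp
      omega

/-- The coefficients in `M ^ j = pⱼ M - d pⱼ₋₁` for a `2 × 2` matrix `M` of trace `t` and
determinant `d`. -/
def powCoeff (t d : K) : ℕ → K
  | 0 => 0
  | 1 => 1
  | j + 2 => t * powCoeff t d (j + 1) - d * powCoeff t d j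

/-- Rescaling a matrix of trace `t` and determinant `d` by `t / d` makes both trace and determinant
equal to `k = t² / d`; free of denominators, the identity also covers `t = 0`. -/
theorem pow_mul_powCoeff {t d k : K} (h : d * k = t ^ 2) (j : ℕ) :
    t ^ j * powCoeff t d (j + 1) = d ^ j * (powPoly K (j + 1)).eval k := by
  induction j using Nat.strong_induction_on with
  | _ j ih =>
    match j, ih with
    | 0, _ => simp [powPoly, powCoeff]
    | 1, _ => simp [powPoly, powCoeff, h, sq]
    | j + 2, ih =>
      have h1 := ih (j + 1) (by omega)
      have h2 := ih j (by omega)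
      rw [powCoeff, powPoly]
      simp only [Polynomial.eval_mul, Polynomial.eval_X, Polynomial.eval_sub]
      linear_combination t ^ 2 * h1 - d * t ^ 2 * h2 - (d ^ (j + 1) *
        (powPoly K (j + 2)).eval k - d ^ (j + 1) * (powPoly K (j + 1)).eval k) * h

/-- The identity `M ^ (j + 1) = pⱼ₊₁ M - d pⱼ` for `M = !![a, b; c, e]`, applied to the vector
`(x₀, 1)`, where `x` is an orbit of the Möbius transformation of `M`: the left-hand vector is a
multiple of `(xⱼ₊₁, 1)`, and `M (x₀, 1) = (c x₀ + e) (x₁, 1)`. -/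
theorem powCoeff_mul_sub {a b c e : E} {x : ℕ → E}
    (hx : ∀ j, x (j + 1) * (c * x j + e) = a * x j + b) (j : ℕ) :
    powCoeff (a + e) (a * e - b * c) (j + 1) * (c * x 0 + e) * (x 1 - x (j + 1)) =
      (a * e - b * c) * powCoeff (a + e) (a * e - b * c) j * (x 0 - x (j + 1)) := by
  induction j with
  | zero => simp [powCoeff]
  | succ j ih =>
    have h0 := hx 0
    have h1 := hx (j + 1)
    rw [powCoeff]
    set p := powCoeff (a + e) (a * e - b * c) (j + 1)
    set r := powCoeff (a + e) (a * e - b * c) j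
    simp only [zero_add] at h0 ⊢
    linear_combination (e * p - (a * e - b * c) * r + x (j + 1 + 1) * c * p) * h0 +
      (a - x (j + 1 + 1) * c) * ih - (p * (c * x 0 + e) - (a * e - b * c) * r) * h1

theorem map_powCoeff (t d : K) (j : ℕ) :
    algebraMap K E (powCoeff t d j) = powCoeff (algebraMap K E t) (algebraMap K E d) j := by
  induction j using Nat.strong_induction_on with
  | _ j ih =>
    match j, ih with
    | 0, _ => simp [powCoeff]
    | 1, _ => simp [powCoeff]
    | j + 2, ih => simp [powCoeff, ih (j + 1) (by omega), ih j (by omega)]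

/-- If `φ` has order dividing `n` and acts on `α` as `[A]`, then `A ^ n` is scalar, which is an
equation for the invariant `(tr A)² / det A`. -/
theorem eval_powPoly_eq_zero (φ : E →ₐ[K] E) {α : E} (hα : 2 < (minpoly K α).natDegree)
    (hφ : φ α ≠ α) {A : Matrix.GeneralLinearGroup (Fin 2) K} (hA : φ α = moebius A α) {n : ℕ}
    (hn : 0 < n) (hφn : φ^[n] α = α) :
    (powPoly K n).eval (A.1.trace ^ 2 / A.1.det) = 0 := by
  obtain ⟨m, rfl⟩ : ∃ m, n = m + 1 := ⟨n - 1, by omega⟩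
  have hN0 := denom_ne_zero hα A
  have hx : ∀ j, φ^[j + 1] α *
      (algebraMap K E (A.1 1 0) * φ^[j] α + algebraMap K E (A.1 1 1)) =
      algebraMap K E (A.1 0 0) * φ^[j] α + algebraMap K E (A.1 0 1) := by
    intro j
    induction j with
    | zero => simp [hA, moebius, div_mul_cancel₀ _ hN0]
    | succ j ih =>
      have := congrArg φ ih
      simpa only [map_mul, map_add, AlgHom.commutes, ← Function.iterate_succ_apply'] using this
  have h1 := powCoeff_mul_sub (x := fun j => φ^[j] α) hx m
  rw [hφn] at h1
  simp only [Function.iterate_zero, id, sub_self, mul_zero, Function.iterate_one] at h1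
  have h2 : powCoeff A.1.trace A.1.det (m + 1) = 0 := by
    rw [← map_eq_zero (algebraMap K E), map_powCoeff, Matrix.trace_fin_two, Matrix.det_fin_two]
    simpa [hN0, sub_ne_zero.2 hφ] using h1
  have hd := A.det_ne_zero
  have h3 := pow_mul_powCoeff (t := A.1.trace) (mul_div_cancel₀ (A.1.trace ^ 2) hd) m
  rw [h2, mul_zero, eq_comm] at h3
  simpa [hd] using h3

end CrossRatio

/-! ### Counting the projective linear sets preserved by the Frobenius automorphism over `K` -/

section Frobenius

variable {K E : Type*} [Field K] [Field E] [Algebra K E] [Fintype K]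

/-- The elements with a given cross-ratio `k` are roots of
`W(X ^ Q - X)`, where `W = X ^ (Q² - 1) + X ^ (Q - 1) + (1 - k) X ^ (Q² - Q) + 1`. -/
theorem ncard_conjCrossRatio_le [Finite E] (k : E) :
    {α : E | FiniteField.frobeniusAlgHom K E α ≠ α ∧
      conjCrossRatio (FiniteField.frobeniusAlgHom K E) α = k}.ncard ≤
      Fintype.card K ^ 3 - Fintype.card K := by
  classical
  set φ := FiniteField.frobeniusAlgHom K E with hφ
  have hQ : 1 < Fintype.card K := Fintype.one_lt_card
  have hφx : ∀ x, φ x = x ^ Fintype.card K := fun x => rfl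
  set Q := Fintype.card K
  have hQ2 : Q < Q ^ 2 := by nlinarith
  let W : E[X] := Polynomial.X ^ (Q ^ 2 - 1) + (Polynomial.X ^ (Q - 1) +
    Polynomial.C (1 - k) * Polynomial.X ^ (Q ^ 2 - Q) + 1)
  have hWlt : (Polynomial.X ^ (Q - 1) +
    Polynomial.C (1 - k) * Polynomial.X ^ (Q ^ 2 - Q) + 1 : E[X]).natDegree < Q ^ 2 - 1 := by
    have : (Polynomial.X ^ (Q - 1) +
      Polynomial.C (1 - k) * Polynomial.X ^ (Q ^ 2 - Q) + 1 : E[X]).natDegree ≤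
        max (Q - 1) (Q ^ 2 - Q) := by
      compute_degree
    omega
  have hWdeg : W.natDegree = Q ^ 2 - 1 := by
    rw [Polynomial.natDegree_add_eq_left_of_natDegree_lt, Polynomial.natDegree_X_pow]
    rwa [Polynomial.natDegree_X_pow]
  let f : E[X] := W.comp (Polynomial.X ^ Q - Polynomial.X)
  have hfdeg : f.natDegree = Q ^ 3 - Q := by
    rw [Polynomial.natDegree_comp, hWdeg, FiniteField.X_pow_card_sub_X_natDegree_eq E hQ,
      Nat.sub_mul, one_mul]
    ring_nf
  have hf0 : f ≠ 0 := by
    rintro h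
    rw [h, Polynomial.natDegree_zero] at hfdeg
    have : Q < Q ^ 3 := by nlinarith
    omega
  have hsub : {α : E | φ α ≠ α ∧ conjCrossRatio φ α = k} ⊆ (f.roots.toFinset : Set E) := by
    rintro α ⟨hα, hk⟩
    rw [Finset.mem_coe, Multiset.mem_toFinset, Polynomial.mem_roots hf0, Polynomial.IsRoot]
    set u := φ α - α with hu
    have hu0 : u ≠ 0 := sub_ne_zero.2 hα
    have hu1 : φ (φ α) - φ α = u ^ Q := by rw [← map_sub, ← hu, hφx]
    have hu2 : φ (φ (φ α)) - φ (φ α) = u ^ Q ^ 2 := by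
      rw [← map_sub, hu1, hφx, ← pow_mul, sq]
    -- the equation for the cross-ratio in terms of `u`; division by `u ^ (Q + 1)` gives `W(u) = 0`
    have e : (u + u ^ Q) * (u ^ Q + u ^ Q ^ 2) = k * (u * u ^ Q ^ 2) := by
      rw [conjCrossRatio, div_eq_iff] at hk
      · rw [← hu1, ← hu2, hu]
        linear_combination hk
      · rw [← neg_sub (φ α), ← neg_sub (φ (φ (φ α))), hu2]
        exact mul_ne_zero (neg_ne_zero.2 hu0) (neg_ne_zero.2 (pow_ne_zero _ hu0))
    have hev : f.eval α = u ^ (Q ^ 2 - 1) + (u ^ (Q - 1) + (1 - k) * u ^ (Q ^ 2 - Q) + 1) := by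
      simp [f, W, hu, hφx]
    rw [hev]
    refine (mul_eq_zero_iff_left (pow_ne_zero (Q + 1) hu0)).1 ?_
    have e1 : u ^ (Q ^ 2 - 1) * u ^ (Q + 1) = u ^ Q ^ 2 * u ^ Q := by
      rw [← pow_add, ← pow_add]; congr 1; omega
    have e2 : u ^ (Q - 1) * u ^ (Q + 1) = u ^ Q * u ^ Q := by
      rw [← pow_add, ← pow_add]; congr 1; omega
    have e3 : u ^ (Q ^ 2 - Q) * u ^ (Q + 1) = u ^ Q ^ 2 * u := by
      rw [← pow_add, ← pow_succ]; congr 1; omega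
    linear_combination e1 + e2 + (1 - k) * e3 + e
  calc _ ≤ (f.roots.toFinset : Set E).ncard := Set.ncard_le_ncard hsub
    _ = f.roots.toFinset.card := Set.ncard_coe_finset _
    _ ≤ f.natDegree := (Multiset.toFinset_card_le _).trans (Polynomial.card_roots' f)
    _ = _ := hfdeg

/-- The cross-ratio determines the preserved projective linear sets: two disjoint ones with the same
cross-ratio `k` would provide `2 (Q³ - Q)` elements of cross-ratio `k`, twice as many as there can
be. -/
theorem projectiveLinearSet_eq_of_conjCrossRatio [Finite E] {α β : E}
    (hα : 2 < (minpoly K α).natDegree) (hβ : 2 < (minpoly K β).natDegree)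
    (hα' : FiniteField.frobeniusAlgHom K E α ≠ α) (hβ' : FiniteField.frobeniusAlgHom K E β ≠ β)
    (hαO : FiniteField.frobeniusAlgHom K E α ∈ projectiveLinearSet K α)
    (hβO : FiniteField.frobeniusAlgHom K E β ∈ projectiveLinearSet K β)
    (h : conjCrossRatio (FiniteField.frobeniusAlgHom K E) α =
      conjCrossRatio (FiniteField.frobeniusAlgHom K E) β) :
    projectiveLinearSet K α = projectiveLinearSet K β := by
  by_cases hd : Disjoint (projectiveLinearSet K α) (projectiveLinearSet K β)
  · exfalso
    have hsub : projectiveLinearSet K α ∪ projectiveLinearSet K β ⊆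
        {γ : E | FiniteField.frobeniusAlgHom K E γ ≠ γ ∧
          conjCrossRatio (FiniteField.frobeniusAlgHom K E) γ =
            conjCrossRatio (FiniteField.frobeniusAlgHom K E) α} := by
      obtain ⟨A, hA⟩ := hαO
      obtain ⟨B, hB⟩ := hβO
      rintro γ (⟨C, rfl⟩ | ⟨C, rfl⟩)
      · exact conjCrossRatio_moebius _ hα hα' hA.symm C
      · rw [h]
        exact conjCrossRatio_moebius _ hβ hβ' hB.symm C
    have h1 := (Set.ncard_le_ncard hsub).trans (ncard_conjCrossRatio_le _)
    rw [Set.ncard_union_eq hd, ncard_projectiveLinearSet hα, ncard_projectiveLinearSet hβ] at h1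
    have hQ : 1 < Fintype.card K := Fintype.one_lt_card
    have : Fintype.card K < Fintype.card K ^ 3 := lt_self_pow₀ hQ (by norm_num)
    omega
  · obtain ⟨γ, h1, h2⟩ := Set.not_disjoint_iff.1 hd
    rw [← projectiveLinearSet_eq_of_mem hα h1, projectiveLinearSet_eq_of_mem hβ h2]

theorem frobeniusAlgHom_apply_ne [Finite E] {α : E} (hα : 2 < (minpoly K α).natDegree) :
    FiniteField.frobeniusAlgHom K E α ≠ α := by
  intro h
  obtain ⟨x, hx⟩ := (IsGalois.mem_range_algebraMap_iff_fixed (F := K) α).2 fun g => by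
    obtain ⟨i, rfl⟩ := (FiniteField.bijective_frobeniusAlgEquivOfAlgebraic_pow K E).2 g
    have hi := Function.iterate_fixed h i
    rwa [AlgEquiv.coe_pow]
  exact algebraMap_ne hα x hx

/-- Fewer than `[E : K]` projective linear sets are preserved by the Frobenius automorphism of `E`
over `K`, since each is determined by its cross-ratio, which is a root of a polynomial of degree
`[E : K] - 1`. -/
theorem ncard_frobenius_fixed_lt [Finite E] {r : ℕ} (hr : 2 < r) (hE : Module.finrank K E = r) :
    {X : Set E | ∃ α ∈ elementsOfDegree K E r, projectiveLinearSet K α = X ∧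
      FiniteField.frobeniusAlgHom K E α ∈ projectiveLinearSet K α}.ncard < r := by
  classical
  obtain ⟨m, rfl⟩ : ∃ m, r = m + 1 := ⟨r - 1, by omega⟩
  set φ := FiniteField.frobeniusAlgHom K E with hφ
  have hφn : ∀ α, φ^[m + 1] α = α := by
    intro α
    rw [← AlgHom.coe_pow, ← hE, ← FiniteField.orderOf_frobeniusAlgHom K E, pow_orderOf_eq_one]
    rfl
  have key : ∀ X ∈ {X : Set E | ∃ α ∈ elementsOfDegree K E (m + 1),
      projectiveLinearSet K α = X ∧ φ α ∈ projectiveLinearSet K α},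
      ∃ k ∈ (powPoly K (m + 1)).roots.toFinset, ∃ α ∈ elementsOfDegree K E (m + 1),
        projectiveLinearSet K α = X ∧ φ α ∈ projectiveLinearSet K α ∧
          conjCrossRatio φ α = algebraMap K E k := by
    rintro X ⟨α, hα, rfl, hO⟩
    obtain ⟨A, hA⟩ := id hO
    have hα2 : 2 < (minpoly K α).natDegree := by
      rw [show (minpoly K α).natDegree = m + 1 from hα]; exact hr
    have hne := frobeniusAlgHom_apply_ne hα2
    refine ⟨_, ?_, α, hα, rfl, hO, conjCrossRatio_eq φ hα2 hne hA.symm⟩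
    rw [Multiset.mem_toFinset, Polynomial.mem_roots (powPoly_monic m).1.ne_zero]
    exact eval_powPoly_eq_zero φ hα2 hne hA.symm (by omega) (hφn α)
  choose! k hk α hα hX hO hc using key
  have hle := Set.ncard_le_ncard_of_injOn (t := ((powPoly K (m + 1)).roots.toFinset : Set K)) k
    (fun X h => hk X h) (by
      intro X h Y h' hXY
      have hd : ∀ γ ∈ elementsOfDegree K E (m + 1), 2 < (minpoly K γ).natDegree := fun γ hγ => by
        rw [show (minpoly K γ).natDegree = m + 1 from hγ]; exact hr
      rw [← hX X h, ← hX Y h']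
      have h1 := hd _ (hα X h)
      have h2 := hd _ (hα Y h')
      exact projectiveLinearSet_eq_of_conjCrossRatio h1 h2 (frobeniusAlgHom_apply_ne h1)
        (frobeniusAlgHom_apply_ne h2) (hO X h) (hO Y h') (by rw [hc X h, hc Y h', hXY]))
  rw [Set.ncard_coe_finset] at hle
  have := (Multiset.toFinset_card_le (powPoly K (m + 1)).roots).trans
    (Polynomial.card_roots' _)
  rw [(powPoly_monic m).2] at this
  omega

end Frobenius

/-! ### Orbits of a cyclic group of order `n ^ 2` -/

/-- Every nontrivial subgroup of a cyclic group of order `n ^ 2`, `n` prime, contains the subgroup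
of order `n`. -/
theorem pow_mem_zpowers_of_ne_one {G : Type*} [Group G] {n : ℕ} (hn : n.Prime)
    {g : G} (hg : orderOf g = n ^ 2) {h : G} (hh : h ∈ Subgroup.zpowers g) (h1 : h ≠ 1) :
    g ^ n ∈ Subgroup.zpowers h := by
  obtain ⟨i, rfl⟩ := Subgroup.mem_zpowers_iff.1 hh
  have hi : ¬ ((n ^ 2 : ℕ) : ℤ) ∣ i := by
    rwa [← hg, orderOf_dvd_iff_zpow_eq_one]
  obtain ⟨k, hk, hk'⟩ := (Nat.dvd_prime_pow hn).1 (Int.gcd_dvd_natAbs_right i ((n ^ 2 : ℕ) : ℤ))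
  have hk1 : k ≤ 1 := by
    by_contra hlt
    obtain rfl : k = 2 := by omega
    exact hi (hk' ▸ Int.gcd_dvd_left i _)
  obtain ⟨c, hc⟩ : Int.gcd i ((n ^ 2 : ℕ) : ℤ) ∣ n := by
    rw [hk']
    exact (pow_dvd_pow n hk1).trans (pow_one n).dvd
  have hbez := Int.gcd_eq_gcd_ab i ((n ^ 2 : ℕ) : ℤ)
  refine Subgroup.mem_zpowers_iff.2 ⟨Int.gcdA i ((n ^ 2 : ℕ) : ℤ) * c, ?_⟩
  have hgn : g ^ ((n ^ 2 : ℕ) : ℤ) = 1 := by rw [zpow_natCast, ← hg, pow_orderOf_eq_one]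
  have hnc : (n : ℤ) = i * (Int.gcdA i ((n ^ 2 : ℕ) : ℤ) * c) +
      ((n ^ 2 : ℕ) : ℤ) * (Int.gcdB i ((n ^ 2 : ℕ) : ℤ) * c) := by
    have : (n : ℤ) = (Int.gcd i ((n ^ 2 : ℕ) : ℤ) : ℤ) * c := by exact_mod_cast hc
    rw [this, hbez]
    ring
  rw [← zpow_natCast g n, hnc, zpow_add, zpow_mul g ((n ^ 2 : ℕ) : ℤ), hgn, one_zpow, mul_one,
    ← zpow_mul]

/-- If the elements of order `n` fix fewer than `n` points, then every nontrivial element has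
exactly `|X| % n` fixed points, because the number of fixed points is congruent to `|X|`
modulo `n`. -/
theorem card_orbits_mul_sq {G X : Type*} [Group G] [MulAction G X] [Finite X] {n : ℕ}
    (hn : n.Prime) {g : G} (hg : orderOf g = n ^ 2) (htop : ∀ h : G, h ∈ Subgroup.zpowers g)
    (hlt : Nat.card (MulAction.fixedBy X (g ^ n)) < n) :
    Nat.card (MulAction.orbitRel.Quotient G X) * n ^ 2 =
      Nat.card X + (n ^ 2 - 1) * (Nat.card X % n) := by
  classical
  have : Fact n.Prime := ⟨hn⟩
  have hcard : Nat.card G = n ^ 2 := by rw [← hg, orderOf_eq_card_of_forall_mem_zpowers htop]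
  have : Finite G := Nat.finite_of_card_ne_zero (by rw [hcard]; exact pow_ne_zero _ hn.ne_zero)
  have := Fintype.ofFinite G
  have := Fintype.ofFinite X
  have hfix : ∀ h : G, h ≠ 1 → Nat.card (MulAction.fixedBy X h) = Nat.card X % n := by
    intro h h1
    have hsub : MulAction.fixedBy X h ⊆ MulAction.fixedBy X (g ^ n) := by
      obtain ⟨i, hi⟩ := Subgroup.mem_zpowers_iff.1 (pow_mem_zpowers_of_ne_one hn hg (htop h) h1)
      rw [← hi]
      exact MulAction.fixedBy_subset_fixedBy_zpow X h i
    have hlt' : Nat.card (MulAction.fixedBy X h) < n := by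
      refine lt_of_le_of_lt ?_ hlt
      rw [Nat.card_coe_set_eq, Nat.card_coe_set_eq]
      exact Set.ncard_le_ncard hsub
    have hP : IsPGroup n (Subgroup.zpowers h) :=
      (IsPGroup.of_card hcard).to_subgroup _
    have hmod := hP.card_modEq_card_fixedPoints X
    have heq : MulAction.fixedPoints (Subgroup.zpowers h) X = MulAction.fixedBy X h := by
      ext x
      rw [MulAction.mem_fixedPoints, MulAction.mem_fixedBy]
      refine ⟨fun H => H ⟨h, Subgroup.mem_zpowers h⟩, ?_⟩
      rintro H ⟨_, i, rfl⟩
      exact MulAction.fixedBy_subset_fixedBy_zpow X h i H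
    rw [heq] at hmod
    rw [hmod, Nat.mod_eq_of_lt hlt']
  have hB := MulAction.sum_card_fixedBy_eq_card_orbits_mul_card_group G X
  rw [← Nat.card_eq_fintype_card, ← Nat.card_eq_fintype_card (α := G), hcard] at hB
  rw [← hB, ← Finset.add_sum_erase _ _ (Finset.mem_univ (1 : G))]
  congr 1
  · rw [← Nat.card_eq_fintype_card, MulAction.fixedBy_one_eq_univ, Nat.card_coe_set_eq,
      Set.ncard_univ]
  · rw [Finset.sum_congr rfl (g := fun _ => Nat.card X % n), Finset.sum_const,
      Finset.card_erase_of_mem (Finset.mem_univ _), Finset.card_univ, ← Nat.card_eq_fintype_card,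
      hcard, smul_eq_mul]
    intro h hh
    rw [← Nat.card_eq_fintype_card]
    exact hfix h (Finset.ne_of_mem_erase hh)

/-! ### The numbers of projective linear sets and of their Frobenius orbits -/

section Count

theorem mem_elementsOfDegree_iff {K E : Type*} [Field K] [Field E] [Algebra K E] {n : ℕ}
    (hn : n.Prime) (hE : Module.finrank K E = n) {α : E} :
    α ∈ elementsOfDegree K E n ↔ α ∉ Set.range (algebraMap K E) := by
  have : FiniteDimensional K E := Module.finite_of_finrank_pos (hE ▸ hn.pos)
  have hint : IsIntegral K α := .of_finite K α
  have hiff : (minpoly K α).natDegree = 1 ↔ α ∈ Set.range (algebraMap K E) := by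
    rw [minpoly.natDegree_eq_one_iff]
    rfl
  rw [← hiff, elementsOfDegree, Set.mem_ofPred_eq]
  have hdvd : (minpoly K α).natDegree ∣ n := hE ▸ minpoly.degree_dvd hint
  rcases (Nat.dvd_prime hn).1 hdvd with h | h
  · simp [h, hn.one_lt.ne]
  · simp [h, hn.one_lt.ne']

theorem ncard_elementsOfDegree {K E : Type*} [Field K] [Field E] [Algebra K E] [Fintype K]
    [Fintype E] {n : ℕ} (hn : n.Prime) (hE : Module.finrank K E = n) :
    (elementsOfDegree K E n).ncard = Fintype.card K ^ n - Fintype.card K := by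
  have h : elementsOfDegree K E n = (Set.range (algebraMap K E))ᶜ :=
    Set.ext fun α => mem_elementsOfDegree_iff hn hE
  rw [h, Set.ncard_compl, ← Set.image_univ,
    Set.ncard_image_of_injective _ (algebraMap K E).injective, Set.ncard_univ,
    Nat.card_eq_fintype_card, Nat.card_eq_fintype_card, Module.card_eq_pow_finrank (K := K), hE]

/-- The projective linear sets of the elements of degree `n` partition them into classes of
`Q³ - Q` elements. -/
theorem ncard_image_projectiveLinearSet {K E : Type*} [Field K] [Field E] [Algebra K E]
    [Fintype K] [Fintype E] {n : ℕ} (hn : n.Prime) (hn2 : 2 < n)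
    (hE : Module.finrank K E = n) :
    (projectiveLinearSet K '' elementsOfDegree K E n).ncard *
      (Fintype.card K ^ 3 - Fintype.card K) = Fintype.card K ^ n - Fintype.card K := by
  classical
  have hdeg : ∀ α ∈ elementsOfDegree K E n, 2 < (minpoly K α).natDegree := fun α hα => by
    rw [show (minpoly K α).natDegree = n from hα]; exact hn2
  rw [← ncard_elementsOfDegree hn hE, Set.ncard_eq_toFinset_card' (elementsOfDegree K E n),
    Finset.card_eq_sum_card_image (projectiveLinearSet K), Finset.sum_const_nat
      (m := Fintype.card K ^ 3 - Fintype.card K)]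
  · congr 1
    rw [← Set.ncard_coe_finset, Finset.coe_image, Set.coe_toFinset]
  · intro X hX
    obtain ⟨α, hα, rfl⟩ := Finset.mem_image.1 hX
    rw [Set.mem_toFinset] at hα
    rw [← ncard_projectiveLinearSet (hdeg α hα), ← Set.ncard_coe_finset]
    congr 1
    ext β
    rw [Finset.mem_coe, Finset.mem_filter, Set.mem_toFinset, projectiveLinearSet_eq_iff (hdeg α hα)]
    exact ⟨fun h => h.2, fun h => ⟨projectiveLinearSet_subset hn2 hα h, h⟩⟩

variable (F K E : Type*) [Field F] [Field K] [Field E] [Fintype F] [Fintype K] [Fintype E]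
  [Algebra F K] [Algebra K E] [Algebra F E] [IsScalarTower F K E]

/-- Burnside's lemma for the Frobenius group, whose element `σ ^ n` is the Frobenius automorphism
of `E` over `K`. -/
theorem numOrbits_mul_sq {n : ℕ} (hn : n.Prime) (hn2 : 2 < n)
    (hK : Module.finrank F K = n) (hE : Module.finrank K E = n) :
    numOrbits F K E n * n ^ 2 = (projectiveLinearSet K '' elementsOfDegree K E n).ncard +
      (n ^ 2 - 1) * ((projectiveLinearSet K '' elementsOfDegree K E n).ncard % n) := by
  let σ : frobeniusGroup F E :=
    ⟨FiniteField.frobeniusAlgEquivOfAlgebraic F E, Subgroup.mem_zpowers _⟩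
  have hσ : orderOf σ = n ^ 2 := by
    rw [← Subgroup.orderOf_coe]
    exact (FiniteField.orderOf_frobeniusAlgEquivOfAlgebraic F E).trans
      (by rw [← Module.finrank_mul_finrank F K E, hK, hE, sq])
  have htop : ∀ h : frobeniusGroup F E, h ∈ Subgroup.zpowers σ := by
    rintro ⟨_, i, rfl⟩
    exact ⟨i, Subtype.ext rfl⟩
  have hσn : ∀ α : E, ((σ ^ n : frobeniusGroup F E) : E ≃ₐ[F] E) α =
      FiniteField.frobeniusAlgHom K E α := by
    intro α
    rw [SubgroupClass.coe_pow, AlgEquiv.coe_pow,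
      FiniteField.coe_frobeniusAlgEquivOfAlgebraic_iterate, FiniteField.coe_frobeniusAlgHom,
      Module.card_eq_pow_finrank (K := F) (V := K), hK]
  have hX : Nat.card (projectiveLinearSets F K E n) =
      (projectiveLinearSet K '' elementsOfDegree K E n).ncard := Nat.card_coe_set_eq _
  rw [← hX]
  refine card_orbits_mul_sq hn hσ htop (lt_of_le_of_lt ?_ (ncard_frobenius_fixed_lt hn2 hE))
  rw [← Nat.card_coe_set_eq]
  refine Nat.card_le_card_of_injective (fun Y => ⟨Y.1.1, ?_⟩) ?_
  · obtain ⟨⟨_, α, hα, rfl⟩, hY⟩ := Y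
    refine ⟨α, hα, rfl, ?_⟩
    have h1 : ((σ ^ n : frobeniusGroup F E) : E ≃ₐ[F] E) • projectiveLinearSet K α =
        projectiveLinearSet K α := congrArg Subtype.val hY
    rw [smul_projectiveLinearSet, AlgEquiv.smul_def, hσn] at h1
    rw [← h1]
    exact mem_projectiveLinearSet_self _
  · intro Y Z h
    exact Subtype.ext (Subtype.ext (Subtype.mk.inj h))

end Count

/-! ### The number of projective linear sets modulo `n` -/

section Residue

variable {n Q x : ℕ}

theorem mul_sq_sub_one (hn : 2 < n) (hQ : 1 < Q) (h : x * (Q ^ 3 - Q) = Q ^ n - Q) :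
    (x : ℤ) * ((Q : ℤ) ^ 2 - 1) = (Q : ℤ) ^ (n - 1) - 1 := by
  zify [Nat.le_self_pow (three_ne_zero) Q, Nat.le_self_pow (by omega : n ≠ 0) Q] at h
  refine mul_left_cancel₀ (a := (Q : ℤ)) (by positivity) ?_
  obtain ⟨m, rfl⟩ : ∃ m, n = m + 1 := ⟨n - 1, by omega⟩
  rw [Nat.add_sub_cancel]
  linear_combination h

theorem mod_eq_of_natCast_eq {a : ℕ} (ha : a < n) (h : (x : ZMod n) = a) : x % n = a := by
  rw [← Nat.mod_eq_of_lt ha]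
  exact (ZMod.natCast_eq_natCast_iff' _ _ _).1 h

theorem mod_eq_one (hn : 2 < n) (h : (x : ℤ) * ((Q : ℤ) ^ 2 - 1) = (Q : ℤ) ^ (n - 1) - 1)
    (hQ : n ∣ Q) : x % n = 1 := by
  apply mod_eq_of_natCast_eq (by omega)
  have hz := congrArg (Int.cast : ℤ → ZMod n) h
  push_cast at hz
  rw [(ZMod.natCast_eq_zero_iff Q n).2 hQ, zero_pow two_ne_zero, zero_pow (by omega)] at hz
  push_cast
  linear_combination -hz

theorem mod_eq_zero (hn : n.Prime) (h : (x : ℤ) * ((Q : ℤ) ^ 2 - 1) = (Q : ℤ) ^ (n - 1) - 1)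
    (hQ : ¬ n ∣ Q) (hQ2 : (Q : ZMod n) ^ 2 ≠ 1) : x % n = 0 := by
  have : Fact n.Prime := ⟨hn⟩
  apply mod_eq_of_natCast_eq hn.pos
  have hz := congrArg (Int.cast : ℤ → ZMod n) h
  push_cast at hz
  rw [ZMod.pow_card_sub_one_eq_one (by rwa [Ne, ZMod.natCast_eq_zero_iff]), sub_self,
    mul_eq_zero, or_iff_left (sub_ne_zero.2 hQ2)] at hz
  simpa using hz

/-- If `Q² ≡ 1` modulo `n`, then each of the `(n - 1) / 2` terms of the geometric sum
`(Q ^ (n - 1) - 1) / (Q² - 1)` is `1` modulo `n`. -/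
theorem mod_eq_half {m : ℕ} (hn : n = 2 * m + 1) (hQ1 : 1 < Q)
    (h : (x : ℤ) * ((Q : ℤ) ^ 2 - 1) = (Q : ℤ) ^ (n - 1) - 1)
    (hQ2 : (Q : ZMod n) ^ 2 = 1) : x % n = m := by
  apply mod_eq_of_natCast_eq (by omega)
  have hne : (Q : ℤ) ^ 2 - 1 ≠ 0 := by
    have : (1 : ℤ) < Q := by exact_mod_cast hQ1
    nlinarith
  have hx : (x : ℤ) = ∑ i ∈ Finset.range m, ((Q : ℤ) ^ 2) ^ i := by
    apply mul_right_cancel₀ hne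
    rw [geom_sum_mul, h, ← pow_mul, hn, Nat.add_sub_cancel]
  have hz := congrArg (Int.cast : ℤ → ZMod n) hx
  push_cast at hz
  simpa [hQ2] using hz

end Residue

/-! ### Extended Goppa codes of elements with the same orbit -/

section Codes

variable {F K E : Type*} [Field F] [Field K] [Field E] [Algebra F K] [Algebra K E]
  [Algebra F E] [IsScalarTower F K E]

/-- Finite extensions of `K` of the same degree are isomorphic, so `E` contains a root of `g`. -/
theorem exists_aeval_eq_zero [Finite E] {g : K[X]} (hg : Irreducible g)
    (hE : Module.finrank K E = g.natDegree) : ∃ α : E, Polynomial.aeval α g = 0 := by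
  have : Fact (Irreducible g) := ⟨hg⟩
  have : FiniteDimensional K (AdjoinRoot g) := (AdjoinRoot.powerBasis hg.ne_zero).finite
  have hr : Module.finrank K (AdjoinRoot g) = g.natDegree := by
    rw [(AdjoinRoot.powerBasis hg.ne_zero).finrank, AdjoinRoot.powerBasis_dim]
  have : Finite K := Finite.of_injective _ (algebraMap K E).injective
  have : Finite (AdjoinRoot g) := Module.finite_of_finite K
  obtain ⟨f⟩ := FiniteField.nonempty_algHom_of_finrank_dvd (F := K) (K := AdjoinRoot g) (L := E)
    (by rw [hr, hE])
  refine ⟨f (AdjoinRoot.root g), ?_⟩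
  rw [Polynomial.aeval_algHom_apply]
  simp

theorem mem_goppaCode_iff [Fintype K] {g : K[X]} (hg : Irreducible g) {α : E}
    (hα : Polynomial.aeval α g = 0) (c : K → F) :
    c ∈ goppaCode F g ↔ ∑ ζ : K, c ζ • (α - algebraMap K E ζ)⁻¹ = 0 := by
  have : Fact (Irreducible g) := ⟨hg⟩
  let f : AdjoinRoot g →ₐ[K] E := AdjoinRoot.liftAlgHom g (Algebra.ofId K E) α hα
  have hf : f (∑ ζ : K, c ζ • Ring.inverse (AdjoinRoot.root g - AdjoinRoot.of g ζ)) =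
      ∑ ζ : K, c ζ • (α - algebraMap K E ζ)⁻¹ := by
    rw [map_sum]
    refine Finset.sum_congr rfl fun ζ _ => ?_
    rw [← algebraMap_smul K (c ζ), map_smul, algebraMap_smul, Ring.inverse_eq_inv', map_inv₀,
      map_sub]
    congr 3
    · exact AdjoinRoot.liftAlgHom_root ..
    · exact f.commutes ζ
  rw [← hf, map_eq_zero]
  rfl

/-- The function `P ↦ 1 / (α - P)` on the projective line `K ∪ {∞}`, with value `0` at `∞`. -/
noncomputable def invSub (α : E) : Option K → E
  | none => 0
  | some ζ => (α - algebraMap K E ζ)⁻¹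

/-- The extended Goppa code consists of the vectors orthogonal to the constant functions and to
`P ↦ 1 / (α - P)` on the projective line. -/
theorem mem_extendedGoppaCode_iff [Fintype K] {g : K[X]} (hg : Irreducible g) {α : E}
    (hα : Polynomial.aeval α g = 0) (c : Option K → F) :
    c ∈ extendedGoppaCode F g ↔ ∑ P, c P • invSub α P = 0 ∧ ∑ P, c P = 0 := by
  rw [Fintype.sum_option (fun P => c P • invSub α P)]
  simp only [invSub, smul_zero, zero_add]
  rw [← mem_goppaCode_iff hg hα]
  rfl

/-- Two extended Goppa codes are equivalent when a permutation of the projective line carries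
`P ↦ 1 / (α - P)` to a nonconstant affine function of `P ↦ 1 / (β - P)`. -/
theorem codeEquivalence_of_affine [Fintype K] {g h : K[X]} (hg : Irreducible g)
    (hh : Irreducible h) {α β : E} (hα : Polynomial.aeval α g = 0) (hβ : Polynomial.aeval β h = 0)
    (π : Equiv.Perm (Option K)) (τ : E ≃ₐ[F] E) (l m : E) (hl : l ≠ 0)
    (hπ : ∀ P, invSub β (π P) = l * τ (invSub α P) + m) :
    (codeEquivalence F (Option K)).r (extendedGoppaCode F g) (extendedGoppaCode F h) := by
  refine ⟨π, fun c => ?_⟩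
  rw [mem_extendedGoppaCode_iff hg hα, mem_extendedGoppaCode_iff hh hβ]
  simp only [Function.comp_apply]
  rw [← Equiv.sum_comp π (fun P => c P • invSub β P), Equiv.sum_comp π c]
  refine and_congr_left fun h0 => ?_
  have h0' : ∑ P, c (π P) = 0 := by rw [Equiv.sum_comp π c, h0]
  have h1 : ∑ P, c (π P) • invSub β (π P) = l * τ (∑ P, c (π P) • invSub α P) := by
    simp only [hπ, smul_add, Finset.sum_add_distrib, ← Finset.sum_smul, h0', zero_smul, add_zero,
      map_sum, map_smul, Finset.mul_sum, mul_smul_comm]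
  rw [h1, mul_eq_zero, or_iff_right hl, map_eq_zero_iff τ τ.injective]

/-- `P ↦ 1 / (α - P)` transforms affinely under `GL(2, K)`. -/
theorem invSub_moebius [DecidableEq K] {α : E} (hα : 2 < (minpoly K α).natDegree)
    (A : Matrix.GeneralLinearGroup (Fin 2) K) (P : OnePoint K) :
    invSub (moebius A α) (A • P : OnePoint K) =
      (algebraMap K E (A.1 1 0) * α + algebraMap K E (A.1 1 1)) ^ 2 / algebraMap K E A.1.det *
        invSub α P - algebraMap K E (A.1 1 0) *
        (algebraMap K E (A.1 1 0) * α + algebraMap K E (A.1 1 1)) / algebraMap K E A.1.det := by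
  have hN := denom_ne_zero hα A
  have hd0 := A.det_ne_zero
  have hd : algebraMap K E A.1.det ≠ 0 := (map_ne_zero _).2 hd0
  induction P using OnePoint.rec with
  | infty =>
    rw [OnePoint.smul_infty_eq_ite]
    split_ifs with h
    · have h' : A.1 1 0 = 0 := h
      change (0 : E) = _ * 0 - _
      simp [h']
    · have h' : algebraMap K E (A.1 1 0) ≠ 0 := (map_ne_zero _).2 h
      change (moebius A α - algebraMap K E (A.1 0 0 / A.1 1 0))⁻¹ = _ * 0 - _
      have key : moebius A α - algebraMap K E (A.1 0 0 / A.1 1 0) =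
          -(algebraMap K E A.1.det / (algebraMap K E (A.1 1 0) *
            (algebraMap K E (A.1 1 0) * α + algebraMap K E (A.1 1 1)))) := by
        rw [moebius, map_div₀, div_sub_div _ _ hN h', ← neg_div,
          div_eq_div_iff (mul_ne_zero hN h') (mul_ne_zero h' hN), Matrix.det_fin_two]
        simp only [map_sub, map_mul]
        ring
      rw [key, inv_neg, inv_div]
      ring
  | coe ζ =>
    have hαζ : α - algebraMap K E ζ ≠ 0 := sub_ne_zero.2 (algebraMap_ne hα ζ).symm
    rw [OnePoint.smul_some_eq_ite]
    split_ifs with h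
    · have h' : algebraMap K E (A.1 1 0) * algebraMap K E ζ + algebraMap K E (A.1 1 1) = 0 := by
        rw [← map_mul, ← map_add, ← map_zero (algebraMap K E)]
        exact congrArg _ h
      change (0 : E) = _ * (α - algebraMap K E ζ)⁻¹ - _
      rw [← div_eq_mul_inv, div_div, div_sub_div _ _ (mul_ne_zero hd hαζ) hd, eq_comm,
        div_eq_zero_iff]
      left
      linear_combination (algebraMap K E (A.1 1 0) * α + algebraMap K E (A.1 1 1)) *
        algebraMap K E A.1.det * h'
    · have h' : algebraMap K E (A.1 1 0) * algebraMap K E ζ + algebraMap K E (A.1 1 1) ≠ 0 := by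
        rw [← map_mul, ← map_add]
        exact (map_ne_zero _).2 h
      change (moebius A α - algebraMap K E ((A.1 0 0 * ζ + A.1 0 1) /
        (A.1 1 0 * ζ + A.1 1 1)))⁻¹ = _ * (α - algebraMap K E ζ)⁻¹ - _
      have key : moebius A α - algebraMap K E ((A.1 0 0 * ζ + A.1 0 1) /
          (A.1 1 0 * ζ + A.1 1 1)) = algebraMap K E A.1.det * (α - algebraMap K E ζ) /
            ((algebraMap K E (A.1 1 0) * α + algebraMap K E (A.1 1 1)) *
            (algebraMap K E (A.1 1 0) * algebraMap K E ζ + algebraMap K E (A.1 1 1))) := by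
        simp only [moebius, map_div₀, map_add, map_mul]
        rw [div_sub_div _ _ hN h', Matrix.det_fin_two]
        congr 1
        simp only [map_sub, map_mul]
        ring
      rw [key, inv_div, ← div_eq_mul_inv, div_div, div_sub_div _ _ (mul_ne_zero hd hαζ) hd,
        div_eq_div_iff (mul_ne_zero hd hαζ) (mul_ne_zero (mul_ne_zero hd hαζ) hd)]
      ring

theorem invSub_frobenius [Fintype K] (τ : E ≃ₐ[F] E) (α : E) (P : Option K) :
    invSub (τ α) (P.map (τ.restrictNormal K : K ≃ₐ[F] K)) = τ (invSub α P) := by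
  cases P with
  | none => simp [invSub]
  | some ζ => simp [invSub, AlgEquiv.restrictNormal_commutes]

/-- Elements whose projective linear sets lie in the same orbit of `G` have equivalent extended
Goppa codes. -/
theorem codeEquivalence_moebius [Fintype K] {g h : K[X]} (hg : Irreducible g)
    (hh : Irreducible h) {α β : E} (hα : Polynomial.aeval α g = 0) (hβ : Polynomial.aeval β h = 0)
    (τ : E ≃ₐ[F] E) (hdeg : 2 < (minpoly K (τ α)).natDegree)
    (hαβ : β ∈ projectiveLinearSet K (τ α)) :
    (codeEquivalence F (Option K)).r (extendedGoppaCode F g) (extendedGoppaCode F h) := by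
  classical
  obtain ⟨A, rfl⟩ := hαβ
  have hd : algebraMap K E A.1.det ≠ 0 := (map_ne_zero _).2 A.det_ne_zero
  let π : Equiv.Perm (Option K) :=
    (Equiv.optionCongr (τ.restrictNormal K : K ≃ₐ[F] K).toEquiv).trans
      (MulAction.toPerm A : Equiv.Perm (OnePoint K))
  refine codeEquivalence_of_affine hg hh hα hβ π τ _
    (-(algebraMap K E (A.1 1 0) *
      (algebraMap K E (A.1 1 0) * τ α + algebraMap K E (A.1 1 1)) / algebraMap K E A.1.det))
    (div_ne_zero (pow_ne_zero 2 (denom_ne_zero hdeg A)) hd) fun P => ?_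
  rw [← invSub_frobenius]
  exact (invSub_moebius hdeg A _).trans (sub_eq_add_neg _ _)

end Codes

section Main

variable (F K E : Type*) [Field F] [Field K] [Field E] [Fintype F] [Fintype K] [Fintype E]
  [Algebra F K] [Algebra K E] [Algebra F E] [IsScalarTower F K E]

/-- Each orbit is sent to the code of the minimal polynomial of some `α` with `O(α)` in that orbit.
This is onto up to equivalence: the code of any other root with the same orbit is equivalent. -/
theorem numExtendedIrreducibleGoppaCodes_le {n : ℕ} (hn : 2 < n)
    (hE : Module.finrank K E = n) :
    numExtendedIrreducibleGoppaCodes F K n ≤ numOrbits F K E n := by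
  have hout : ∀ Y : MulAction.orbitRel.Quotient (frobeniusGroup F E)
      (projectiveLinearSets F K E n), ∃ α ∈ elementsOfDegree K E n,
        projectiveLinearSet K α = Y.out.1 := fun Y => Y.out.2
  choose α hα hαY using hout
  have hirr : ∀ β : E, Irreducible (minpoly K β) := fun β => minpoly.irreducible (.of_finite K β)
  let f : MulAction.orbitRel.Quotient (frobeniusGroup F E) (projectiveLinearSets F K E n) →
      Quotient ((codeEquivalence F (Option K)).comap (Subtype.val :
        extendedIrreducibleGoppaCodes F K n → Submodule F (Option K → F))) :=
    fun Y => Quotient.mk _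
      ⟨extendedGoppaCode F (minpoly K (α Y)), minpoly K (α Y), hirr _, hα Y, rfl⟩
  refine Nat.card_le_card_of_surjective f fun C => ?_
  induction C using Quotient.inductionOn with
  | h C =>
    obtain ⟨_, g, hg, hgn, rfl⟩ := C
    obtain ⟨β, hβ⟩ := exists_aeval_eq_zero (E := E) hg (hE.trans hgn.symm)
    have hβn : β ∈ elementsOfDegree K E n := by
      rw [elementsOfDegree, Set.mem_ofPred_eq, ← hgn]
      refine le_antisymm (Polynomial.natDegree_le_of_dvd (minpoly.dvd K β hβ) hg.ne_zero) ?_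
      exact Polynomial.natDegree_le_of_dvd ((hirr β).dvd_symm hg (minpoly.dvd K β hβ))
        (hirr β).ne_zero
    let X : projectiveLinearSets F K E n := ⟨projectiveLinearSet K β, β, hβn, rfl⟩
    let Y : MulAction.orbitRel.Quotient (frobeniusGroup F E) (projectiveLinearSets F K E n) :=
      Quotient.mk _ X
    refine ⟨Y, ?_⟩
    obtain ⟨τ, hτ⟩ : Y.out ∈ MulAction.orbit (frobeniusGroup F E) X :=
      MulAction.orbitRel_apply.1 (Quotient.mk_out X)
    have h1 : projectiveLinearSet K ((τ : E ≃ₐ[F] E) β) = projectiveLinearSet K (α Y) := by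
      rw [hαY, ← hτ]
      exact (smul_projectiveLinearSet K (τ : E ≃ₐ[F] E) β).symm
    have hdeg : (minpoly K ((τ : E ≃ₐ[F] E) β)).natDegree = n :=
      smul_mem_elementsOfDegree K (τ : E ≃ₐ[F] E) hβn
    refine (Quotient.sound ?_).symm
    exact codeEquivalence_moebius hg (hirr _) hβ (minpoly.aeval K (α Y)) (τ : E ≃ₐ[F] E)
      (by omega) (h1 ▸ mem_projectiveLinearSet_self _)

end Main

end GoppaCount

theorem mainTheorem2
    (F K E : Type*) [Field F] [Field K] [Field E] [Fintype F] [Fintype K] [Fintype E]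
    [Algebra F K] [Algebra K E] [Algebra F E] [IsScalarTower F K E]
    (p t q n : ℕ) (hp : p.Prime) (hq : q = p ^ t) (hn : n.Prime) (hn2 : n ≠ 2)
    (hF : Fintype.card F = q) (hK : Module.finrank F K = n) (hE : Module.finrank K E = n) :
    (n = p →
      (GoppaCount.numOrbits F K E n : ℚ) =
        1 / (n : ℚ) ^ 2 * (((q : ℚ) ^ (n * (n - 1)) - 1) / ((q : ℚ) ^ (2 * n) - 1)
          + ((n : ℚ) ^ 2 - 1))) ∧
    (n ≠ p → n ∣ q ^ n - 1 →
      (GoppaCount.numOrbits F K E n : ℚ) =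
        1 / (n : ℚ) ^ 2 * (((q : ℚ) ^ (n * (n - 1)) - 1) / ((q : ℚ) ^ (2 * n) - 1)
          + ((n : ℚ) ^ 2 - 1) * ((n : ℚ) - 1) / 2)) ∧
    (n ≠ p → ¬ n ∣ q ^ n - 1 → n ∣ q ^ n + 1 →
      (GoppaCount.numOrbits F K E n : ℚ) =
        1 / (n : ℚ) ^ 2 * (((q : ℚ) ^ (n * (n - 1)) - 1) / ((q : ℚ) ^ (2 * n) - 1)
          + ((n : ℚ) + 1) * ((n : ℚ) - 1) ^ 2 / 2)) ∧
    (n ≠ p → ¬ n ∣ q ^ n - 1 → ¬ n ∣ q ^ n + 1 →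
      (GoppaCount.numOrbits F K E n : ℚ) =
        1 / (n : ℚ) ^ 2 * (((q : ℚ) ^ (n * (n - 1)) - 1) / ((q : ℚ) ^ (2 * n) - 1))) ∧
    GoppaCount.numExtendedIrreducibleGoppaCodes F K n ≤ GoppaCount.numOrbits F K E n := by
  have hn3 : 2 < n := lt_of_le_of_ne hn.two_le hn2.symm
  have hQ : Fintype.card K = q ^ n := by
    rw [Module.card_eq_pow_finrank (K := F) (V := K), hF, hK]
  have hQ1 : 1 < q ^ n := hQ ▸ Fintype.one_lt_card
  have hcount := GoppaCount.ncard_image_projectiveLinearSet hn hn3 hE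
  have horb := GoppaCount.numOrbits_mul_sq F K E hn hn3 hK hE
  rw [hQ] at hcount
  set x := (GoppaCount.projectiveLinearSet K '' GoppaCount.elementsOfDegree K E n).ncard
  have hx := GoppaCount.mul_sq_sub_one hn3 hQ1 hcount
  have hxq : ((q : ℚ) ^ (n * (n - 1)) - 1) / ((q : ℚ) ^ (2 * n) - 1) = x := by
    have h1 : (1 : ℚ) < (q : ℚ) ^ (2 * n) := by
      rw [mul_comm, pow_mul]
      exact one_lt_pow₀ (by exact_mod_cast hQ1) two_ne_zero
    rw [div_eq_iff (sub_ne_zero.2 h1.ne'), pow_mul, mul_comm 2 n, pow_mul]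
    exact_mod_cast hx.symm
  have hform : (GoppaCount.numOrbits F K E n : ℚ) =
      1 / (n : ℚ) ^ 2 * (((q : ℚ) ^ (n * (n - 1)) - 1) / ((q : ℚ) ^ (2 * n) - 1) +
        ((n : ℚ) ^ 2 - 1) * (x % n : ℕ)) := by
    have h1 : (n : ℚ) ^ 2 ≠ 0 := pow_ne_zero 2 (by exact_mod_cast hn.ne_zero)
    rw [hxq, one_div, eq_inv_mul_iff_mul_eq₀ h1, mul_comm]
    have h2 : 1 ≤ n ^ 2 := Nat.one_le_pow _ _ hn.pos
    have h3 := congrArg (Nat.cast : ℕ → ℚ) horb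
    push_cast [h2] at h3 ⊢
    exact h3
  obtain ⟨m, hm⟩ : ∃ m, n = 2 * m + 1 := hn.odd_of_ne_two hn2
  have hmQ : ((n : ℚ) - 1) / 2 = m := by
    rw [hm]
    push_cast
    ring
  have hndvd : n ≠ p → ¬ n ∣ q ^ n := fun hnp h =>
    hnp ((Nat.prime_dvd_prime_iff_eq hn hp).1
      (hn.dvd_of_dvd_pow (hn.dvd_of_dvd_pow (hq ▸ h))))
  have hminus : n ∣ q ^ n - 1 ↔ ((q ^ n : ℕ) : ZMod n) = 1 := by
    rw [← ZMod.natCast_eq_zero_iff, Nat.cast_sub hQ1.le, Nat.cast_one, sub_eq_zero]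
  have hplus : n ∣ q ^ n + 1 ↔ ((q ^ n : ℕ) : ZMod n) = -1 := by
    rw [← ZMod.natCast_eq_zero_iff, Nat.cast_add, Nat.cast_one, add_eq_zero_iff_eq_neg]
  refine ⟨fun hnp => ?_, fun hnp h => ?_, fun hnp _ h => ?_, fun hnp h h' => ?_,
    GoppaCount.numExtendedIrreducibleGoppaCodes_le F K E hn3 hE⟩
  · have ht : t ≠ 0 := by
      rintro rfl
      rw [hq, pow_zero, one_pow] at hQ1
      exact hQ1.ne rfl
    rw [hform, GoppaCount.mod_eq_one hn3 hx]
    · simp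
    · rw [hq, hnp]
      exact dvd_pow (dvd_pow_self p ht) hp.ne_zero
  · rw [hform, GoppaCount.mod_eq_half hm hQ1 hx (by rw [hminus.1 h, one_pow]), ← hmQ]
    ring
  · rw [hform, GoppaCount.mod_eq_half hm hQ1 hx (by rw [hplus.1 h]; ring), ← hmQ]
    ring
  · have : Fact n.Prime := ⟨hn⟩
    rw [hform, GoppaCount.mod_eq_zero hn hx (hndvd hnp) ?_]
    · simp
    · rw [Ne, sq_eq_one_iff, not_or, ← hminus, ← hplus]
      exact ⟨h, h'⟩
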